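/- Let $n\ge 3$ and let $D=([n],A)$ be an acyclic digraph (no directed cycles), where $[n]=\{1,\dots,n\}$. For $a,b\in[n]$ put $\delta_D(a,b)=1$ if $a<b$ or $(a,b)\in A$, and $\delta_D(a,b)=0$ otherwise. An ordering $\pi=(a_1,\dots,a_n)$ of $[n]$ is $D$-respecting if $(a_i,a_j)\in A$ implies $i<j$; let $\mathcal{OP}(D)$ be the set of these orderings, let $\delta_D(\pi)=\sum_{i=1}^{n-1}\delta_D(a_i,a_{i+1})$, and let $$\Psi(D,x)=\sum_{\pi\in\mathcal{OP}(D)}\binom{x+\delta_D(\pi)}{n}.$$ Let $\bar D$ be the poset on $[n]$ that is the reflexive transitive closure of $D$, and let $\Omega(\bar D,x)$ be its order polynomial: the polynomial whose value at every positive integer $m$ is the number of maps $\sigma:[n]\to[m]$ such that $u\preceq v$ in $\bar D$ implies $\sigma(u)\le\sigma(v)$. Let $\mathcal W(D)$ be the set of $3$-element subsets $\{a,b,c\}$ of $[n]$ with $a<b<c$ such that $(c,a)\in A$, there is no directed path in $D$ between $a$ and $b$ (in either direction), and there is no directed path in $D$ between $b$ and $c$ (in either direction). **Theorem.** There are non-negative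 integers $d_0,d_1,\dots,d_{n-3}$ such that, as polynomials in $x$, $$\Psi(D,x)-\Omega(\bar D,x)=\sum_{i=0}^{n-3}d_i\binom{x+i}{n-2},$$ and $d_i=0$ for all $i=0,1,\dots,n-3$ if and only if $\mathcal W(D)=\emptyset$. Consequently, $\Psi(D,x)=\Omega(\bar D,x)$ if and only if $\mathcal W(D)=\emptyset$. -/

import Mathlib

open Polynomial

/-! ### Order polynomials of finite posets -/

namespace OrderPoly

/-- The number of order-preserving maps from the finite poset `(P, o)` to the chain with `m`
elements. -/
noncomputable def count {P : Type*} (o : PartialOrder P) (m : ℕ) : ℕ :=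
  Nat.card {σ : P → Fin m // ∀ u v, o.le u v → σ u ≤ σ v}

/-- Auxiliary: the number of surjective order-preserving maps to the chain with `k` elements. -/
noncomputable def surjCount {P : Type*} (o : PartialOrder P) (k : ℕ) : ℕ :=
  Nat.card {σ : P → Fin k // (∀ u v, o.le u v → σ u ≤ σ v) ∧ Function.Surjective σ}

theorem card_fiber {P : Type*} [Fintype P] (o : PartialOrder P) (m : ℕ) (s : Finset (Fin m)) :
    Nat.card {σ : P → Fin m // (∀ u v, o.le u v → σ u ≤ σ v) ∧ Finset.univ.image σ = s}
      = surjCount o s.card := by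
  symm
  let e := s.orderEmbOfFin rfl
  have he : Set.range e = s := Finset.range_orderEmbOfFin s rfl
  refine Nat.card_congr (Equiv.ofBijective
    (fun σ => ⟨fun p => e (σ.1 p), fun u v h => e.monotone (σ.2.1 u v h), ?_⟩) ⟨?_, ?_⟩)
  · ext x
    have hx : x ∈ s ↔ x ∈ Set.range e := by rw [he]; simp
    rw [hx]
    simp only [Finset.mem_image, Finset.mem_univ, true_and, Set.mem_range]
    constructor
    · rintro ⟨p, rfl⟩
      exact ⟨_, rfl⟩
    · rintro ⟨y, rfl⟩
      obtain ⟨p, hp⟩ := σ.2.2 y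
      exact ⟨p, by rw [hp]⟩
  · intro σ τ h
    apply Subtype.ext
    funext p
    exact e.injective (congrFun (congrArg Subtype.val h) p)
  · rintro ⟨τ, hτ, hs⟩
    have h1 : ∀ p, ∃ y, e y = τ p := by
      intro p
      have : τ p ∈ Set.range e := by
        rw [he, ← hs]
        simp
      exact this
    choose f hf using h1
    refine ⟨⟨f, fun u v h => ?_, fun y => ?_⟩, ?_⟩
    · have := hτ u v h
      rw [← hf, ← hf] at this
      exact e.le_iff_le.1 this
    · have : e y ∈ Finset.univ.image τ := by
        rw [hs]
        exact Finset.orderEmbOfFin_mem s rfl y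
      obtain ⟨p, -, hp⟩ := Finset.mem_image.1 this
      exact ⟨p, e.injective (by rw [hf, hp])⟩
    · apply Subtype.ext
      funext p
      exact hf p

theorem count_eq_sum {P : Type*} [Fintype P] (o : PartialOrder P) (m : ℕ) :
    count o m = ∑ k ∈ Finset.range (m + 1), m.choose k * surjCount o k := by
  classical
  have h1 : count o m = ∑ s ∈ (Finset.univ : Finset (Fin m)).powerset, surjCount o s.card := by
    have h2 : count o m
        = (Finset.univ.filter fun σ : P → Fin m => ∀ u v, o.le u v → σ u ≤ σ v).card := by
      rw [count, Nat.card_eq_fintype_card, Fintype.card_subtype]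
    rw [h2, Finset.card_eq_sum_card_fiberwise (f := fun σ : P → Fin m => Finset.univ.image σ)
      (t := (Finset.univ : Finset (Fin m)).powerset) (by intro σ _; simp)]
    refine Finset.sum_congr rfl fun s _ => ?_
    rw [← card_fiber, Nat.card_eq_fintype_card, Fintype.card_subtype, Finset.filter_filter]
  rw [h1, Finset.sum_powerset_apply_card]
  simp

theorem surjCount_eq_zero {P : Type*} [Fintype P] (o : PartialOrder P) {k : ℕ}
    (hk : Fintype.card P < k) : surjCount o k = 0 := by
  rw [surjCount, Nat.card_eq_zero]
  left
  constructor
  rintro ⟨σ, -, hσ⟩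
  have := Fintype.card_le_of_surjective σ hσ
  simp at this
  omega

theorem exists_polynomial {P : Type*} [Fintype P] (o : PartialOrder P) :
    ∃ p : ℚ[X], ∀ m : ℕ, 0 < m → p.eval (m : ℚ) = count o m := by
  refine ⟨∑ k ∈ Finset.range (Fintype.card P + 1),
    (surjCount o k : ℚ[X]) * Ring.choose (X : ℚ[X]) k, fun m _ => ?_⟩
  have hev : ∀ k, eval (m : ℚ) (Ring.choose (X : ℚ[X]) k) = (m.choose k : ℚ) := by
    intro k
    have := Ring.map_choose (evalRingHom (m : ℚ)) (X : ℚ[X]) k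
    rw [coe_evalRingHom, eval_X, Ring.choose_natCast] at this
    exact this
  rw [count_eq_sum, eval_finsetSum]
  push_cast
  have hN : ∀ N, N = Fintype.card P ∨ N = m →
      ∑ k ∈ Finset.range (N + 1), ((m.choose k : ℚ) * surjCount o k)
        = ∑ k ∈ Finset.range (max (Fintype.card P) m + 1), ((m.choose k : ℚ) * surjCount o k) := by
    intro N h
    apply Finset.sum_subset
    · intro k hk
      simp only [Finset.mem_range] at hk ⊢
      omega
    · intro k _ hk
      simp only [Finset.mem_range, not_lt] at hk
      rcases h with rfl | rfl
      · rw [surjCount_eq_zero o (by omega)]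
        simp
      · rw [Nat.choose_eq_zero_of_lt (by omega)]
        simp
  rw [hN m (Or.inr rfl), ← hN _ (Or.inl rfl)]
  refine Finset.sum_congr rfl fun k _ => ?_
  rw [eval_mul, hev, eval_natCast, mul_comm]

/-- The order polynomial `Ω(P, x)` of the finite poset `P = (P, o)`: the polynomial whose value at
every positive integer `m` is the number of order-preserving maps `P → [m]`. -/
noncomputable def orderPolynomial {P : Type*} [Fintype P] (o : PartialOrder P) : ℚ[X] :=
  Classical.choose (exists_polynomial o)

theorem eval_orderPolynomial {P : Type*} [Fintype P] (o : PartialOrder P) (m : ℕ) (hm : 0 < m) :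
    (orderPolynomial o).eval (m : ℚ) = count o m :=
  Classical.choose_spec (exists_polynomial o) m hm

theorem eq_orderPolynomial {P : Type*} [Fintype P] (o : PartialOrder P) (p : ℚ[X])
    (hp : ∀ m : ℕ, 0 < m → p.eval (m : ℚ) = count o m) : p = orderPolynomial o := by
  apply eq_of_infinite_eval_eq
  refine ((Set.Ioi_infinite 0).image (Nat.cast_injective (R := ℚ)).injOn).mono ?_
  rintro _ ⟨m, hm, rfl⟩
  exact (hp m hm).trans (eval_orderPolynomial o m hm).symm

end OrderPoly

/-! ### Acyclic digraphs on `[n]`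

The vertex set `[n] = {1 < 2 < ⋯ < n}` is modelled by `Fin n` with its usual order. -/

namespace AcyclicDigraph

/-- A digraph is acyclic if it has no directed cycle (in particular no loop). -/
def IsAcyclic {V : Type*} (D : Digraph V) : Prop :=
  ∀ v, ¬ Relation.TransGen D.Adj v v

/-- The poset `D̄`: the reflexive transitive closure of the acyclic digraph `D`. -/
@[reducible] def closure {V : Type*} (D : Digraph V) (hD : IsAcyclic D) : PartialOrder V where
  le := Relation.ReflTransGen D.Adj
  le_refl _ := Relation.ReflTransGen.refl
  le_trans _ _ _ := Relation.ReflTransGen.trans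
  le_antisymm a b hab hba := by
    rcases Relation.reflTransGen_iff_eq_or_transGen.1 hab with h | h
    · exact h.symm
    · exact absurd (h.trans_left hba) (hD a)

/-- The ordering `(π 0, π 1, …, π (n-1))` of the vertices is `D`-respecting if the tail of every
arc appears before its head. -/
def Respects {n : ℕ} (D : Digraph (Fin n)) (π : Equiv.Perm (Fin n)) : Prop :=
  ∀ i j, D.Adj (π i) (π j) → i < j

open scoped Classical in
/-- `δ_D(a, b)` is `1` if `a < b` or `(a, b)` is an arc, and `0` otherwise. -/
noncomputable def delta {n : ℕ} (D : Digraph (Fin n)) (a b : Fin n) : ℕ :=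
  if a < b ∨ D.Adj a b then 1 else 0

/-- `δ_D(π)`: the sum of `δ_D` over pairs of consecutive entries of the ordering `π`. -/
noncomputable def deltaSum {n : ℕ} (D : Digraph (Fin n)) (π : Equiv.Perm (Fin n)) : ℕ :=
  ∑ i : Fin (n - 1), delta D (π ⟨i, by omega⟩) (π ⟨i + 1, by omega⟩)

open scoped Classical in
/-- `Ψ(D, x)`, the sum over all `D`-respecting orderings `π` of the binomial polynomials
`x + δ_D(π)` choose `n`. -/
noncomputable def Psi {n : ℕ} (D : Digraph (Fin n)) : ℚ[X] :=
  ∑ π : Equiv.Perm (Fin n) with Respects D π,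
    Ring.choose (X + (deltaSum D π : ℚ[X])) n

/-- `a ≉_D b`: there is no directed path from `a` to `b` and none from `b` to `a`. -/
def Unrelated {V : Type*} (D : Digraph V) (a b : V) : Prop :=
  ¬ Relation.TransGen D.Adj a b ∧ ¬ Relation.TransGen D.Adj b a

/-- `W(D)`: the `3`-element sets `{a, b, c}` with `a < b < c` such that `(c, a)` is an arc and `b`
is unrelated to both `a` and `c`. -/
def W {n : ℕ} (D : Digraph (Fin n)) : Set (Finset (Fin n)) :=
  {s | ∃ a b c, a < b ∧ b < c ∧ s = {a, b, c} ∧ D.Adj c a ∧ Unrelated D a b ∧ Unrelated D c b}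

end AcyclicDigraph

/-!
Write `r` for the strict order generated by the arcs of `D`. Consecutive entries of a
`D`-respecting ordering are `r`-related only if they form an arc, so `n - 1 - δ_D(π)` is the number
of descents of the linear extension `π` of `r` that are not relations of `r`. The same statistic
makes sense for every injective labelling `L` of the vertices and gives a polynomial
`descentPoly r L`, a sum of powers `X ^ e`. Replacing `X ^ e` by the binomial polynomial
`x + n - 1 - e` choose `n` (`toBinomial`) turns it into `Ψ(D, x)` for the given labelling, and into
`Ω(D̄, x)` for a natural labelling (Stanley's theory of `P`-partitions, `count_closure`). Under this
replacement `(1 - X) ^ 2 * X ^ e` becomes `x + n - 3 - e` choose `n - 2`. Hence it suffices to write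
the difference of the two descent polynomials as `(1 - X) ^ 2` times a sum of monomials.

The given labelling is turned into a natural one by moving one label at a time. Suppose that only
the label of `u` changes. A linear extension has the form `l₁, u, l₂`; whether the entries next to
`u` belong above or below `u` determines the number of descents, once those of `l₁`, of `l₂` and of
the step from `l₁` to `l₂` are known. In `pow_listCost_cut` the power of `X` is split accordingly
into a part that does not depend on the label of `u`, the signed crossing of the place of `u`
weighted by `1 - X`, and, for the *exceptional* cuts `(l₁, l₂)`, a term `(1 - X) ^ 2 * X ^ e`. The
signed crossings telescope when `u` is moved through the other entries
(`sum_nextAbove_sub_prevAbove`), so their sum does not depend on the label of `u` either, and the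
change of the polynomial is carried by exceptional cuts alone (`descentPoly_sub`).

An exceptional cut at `u` exhibits a *crossing* containing `u`: labels `a < b < c` with `r c a` and
`b` unrelated to both `a` and `c`. Conversely every crossing in which `r c a` is a cover
yields exceptional cuts at each of its three elements, since the triple is a block of some linear
extension. If the elements are moved above all others in decreasing order of a natural labelling,
then no crossing contains the moved element afterwards. So every move contributes non-negatively,
and all contributions vanish if and only if the original labelling has no crossing. Refining
`r c a` to a cover shows that this means `W(D) = ∅`.
-/

namespace LabelledOrder

/-! ### Costs of lists -/

/-- The total cost of the pairs of consecutive entries of a list. -/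
def listCost {V : Type*} (c : V → V → ℕ) : List V → ℕ
  | [] => 0
  | [_] => 0
  | a :: b :: l => c a b + listCost c (b :: l)

/-- The cost of the step from the last entry of `l₁` to the first entry of `l₂`, and `0` if there
is no such step. -/
def joinCost {V : Type*} (c : V → V → ℕ) (l₁ l₂ : List V) : ℕ :=
  match l₁.getLast?, l₂.head? with
  | some a, some b => c a b
  | _, _ => 0

theorem joinCost_nil_left {V : Type*} (c : V → V → ℕ) (l : List V) : joinCost c [] l = 0 := by
  simp [joinCost]

theorem joinCost_nil_right {V : Type*} (c : V → V → ℕ) (l : List V) : joinCost c l [] = 0 := by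
  simp [joinCost]

theorem listCost_append {V : Type*} (c : V → V → ℕ) (l₁ l₂ : List V) :
    listCost c (l₁ ++ l₂) = listCost c l₁ + joinCost c l₁ l₂ + listCost c l₂ := by
  induction l₁ with
  | nil => simp [listCost, joinCost]
  | cons a l ih =>
    cases l with
    | nil => cases l₂ <;> simp [listCost, joinCost]
    | cons b l =>
      have : joinCost c (a :: b :: l) l₂ = joinCost c (b :: l) l₂ := by
        simp [joinCost, List.getLast?_cons_cons]
      simp only [List.cons_append, listCost] at ih ⊢
      rw [ih, this]
      omega

theorem listCost_congr {V : Type*} {c c' : V → V → ℕ} {l : List V}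
    (h : ∀ a ∈ l, ∀ b ∈ l, c a b = c' a b) : listCost c l = listCost c' l := by
  induction l with
  | nil => rfl
  | cons a l ih =>
    cases l with
    | nil => rfl
    | cons b l =>
      simp only [listCost]
      rw [h a (by simp) b (by simp), ih fun x hx y hy => h x (by simp [hx]) y (by simp [hy])]

theorem listCost_lt {V : Type*} {c : V → V → ℕ} (hc : ∀ a b, c a b ≤ 1) {l : List V}
    (hl : l ≠ []) : listCost c l < l.length := by
  induction l with
  | nil => exact absurd rfl hl
  | cons a l ih =>
    cases l with
    | nil => simp [listCost]
    | cons b l =>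
      have := ih (by simp)
      have := hc a b
      simp only [listCost, List.length_cons] at *
      omega

theorem listCost_ofFn {V : Type*} (c : V → V → ℕ) (n : ℕ) (f : Fin (n + 1) → V) :
    listCost c (List.ofFn f) = ∑ i : Fin n, c (f i.castSucc) (f i.succ) := by
  induction n with
  | zero => simp [listCost]
  | succ n ih =>
    rw [List.ofFn_succ, List.ofFn_succ, Fin.sum_univ_succ]
    have := ih fun i => f i.succ
    rw [List.ofFn_succ] at this
    simp only [listCost]
    rw [this]
    rfl

/-! ### Linear extensions cut at a vertex -/

/-- The list `l` runs through all elements of `V` once, and no entry is preceded by an `r`-larger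
one: `l` is a linear extension of `r`. -/
structure IsLinExt {V : Type*} (r : V → V → Prop) (l : List V) : Prop where
  nodup : l.Nodup
  mem : ∀ v, v ∈ l
  pairwise : l.Pairwise fun a b => ¬ r b a

theorem finite_isLinExt {V : Type*} [Finite V] (r : V → V → Prop) :
    {l : List V | IsLinExt r l}.Finite := by
  have := Fintype.ofFinite V
  exact (List.finite_length_le V (Fintype.card V)).subset fun l hl =>
    List.Nodup.length_le_card hl.nodup

/-- The finite set of linear extensions of `r`. -/
noncomputable def linExts {V : Type*} [Finite V] (r : V → V → Prop) : Finset (List V) :=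
  (finite_isLinExt r).toFinset

theorem mem_linExts {V : Type*} [Finite V] {r : V → V → Prop} {l : List V} :
    l ∈ linExts r ↔ IsLinExt r l := by simp [linExts]

theorem injOn_cut {V : Type*} (r : V → V → Prop) (u : V) :
    Set.InjOn (fun p : List V × List V => p.1 ++ u :: p.2)
      {p | IsLinExt r (p.1 ++ u :: p.2)} := by
  rintro ⟨l₁, l₂⟩ h ⟨m₁, m₂⟩ h' he
  have aux := (List.nodup_append.1 h.nodup).2
  obtain ⟨h1, -, h2⟩ := (List.append_cons_inj_of_notMem (a₁ := u)
    (fun hu => aux.2 u hu u (by simp) rfl) (List.nodup_cons.1 aux.1).1).1 he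
  exact Prod.ext h1 h2

theorem finite_cuts {V : Type*} [Finite V] (r : V → V → Prop) (u : V) :
    {p : List V × List V | IsLinExt r (p.1 ++ u :: p.2)}.Finite :=
  Set.Finite.of_finite_image
    ((finite_isLinExt r).subset (by rintro _ ⟨p, hp, rfl⟩; exact hp)) (injOn_cut r u)

/-- The pairs `(l₁, l₂)` for which `l₁, u, l₂` is a linear extension of `r`. -/
noncomputable def cuts {V : Type*} [Finite V] (r : V → V → Prop) (u : V) :
    Finset (List V × List V) :=
  (finite_cuts r u).toFinset

theorem mem_cuts {V : Type*} [Finite V] {r : V → V → Prop} {u : V} {p : List V × List V} :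
    p ∈ cuts r u ↔ IsLinExt r (p.1 ++ u :: p.2) := by simp [cuts]

theorem sum_linExts {V R : Type*} [Finite V] [AddCommMonoid R] (r : V → V → Prop) (u : V)
    (f : List V → R) :
    ∑ l ∈ linExts r, f l = ∑ p ∈ cuts r u, f (p.1 ++ u :: p.2) := by
  symm
  refine Finset.sum_bij (fun p _ => p.1 ++ u :: p.2) (fun p hp => ?_) (fun p hp q hq h => ?_)
    (fun l hl => ?_) fun _ _ => rfl
  · exact mem_linExts.2 (mem_cuts.1 hp)
  · exact injOn_cut r u (mem_cuts.1 hp) (mem_cuts.1 hq) h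
  · obtain ⟨l₁, l₂, rfl⟩ := List.append_of_mem ((mem_linExts.1 hl).mem u)
    exact ⟨(l₁, l₂), mem_cuts.2 (mem_linExts.1 hl), rfl⟩

/-! ### The descent polynomial of a labelled order -/

open scoped Classical in
/-- The pair `(a, b)` costs `1` if it is a descent of the labels and not a relation `r a b`, and
nothing otherwise. -/
noncomputable def descent {V : Type*} (r : V → V → Prop) (L : V → ℕ) (a b : V) : ℕ :=
  if L b < L a ∧ ¬ r a b then 1 else 0

theorem descent_le_one {V : Type*} (r : V → V → Prop) (L : V → ℕ) (a b : V) :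
    descent r L a b ≤ 1 := by
  unfold descent
  split_ifs <;> simp

theorem joinCost_le_one {V : Type*} (r : V → V → Prop) (L : V → ℕ) (l₁ l₂ : List V) :
    joinCost (descent r L) l₁ l₂ ≤ 1 := by
  unfold joinCost
  split
  · exact descent_le_one ..
  · simp

/-- The generating polynomial of the linear extensions of `r` by the number of their descents with
respect to the labelling `L`, steps along `r` not being counted. -/
noncomputable def descentPoly {V : Type*} [Finite V] (r : V → V → Prop) (L : V → ℕ) : ℤ[X] :=
  ∑ l ∈ linExts r, X ^ listCost (descent r L) l

/-- `v` belongs above `u`: it is `r`-above `u`, or unrelated to `u` with the larger label. -/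
def Above {V : Type*} (r : V → V → Prop) (L : V → ℕ) (u v : V) : Prop :=
  r u v ∨ (L u < L v ∧ ¬ r v u)

/-- The last entry of `l` exists and belongs above `u`. -/
def PrevAbove {V : Type*} (r : V → V → Prop) (L : V → ℕ) (u : V) (l : List V) : Prop :=
  ∃ x ∈ l.getLast?, Above r L u x

/-- The first entry of `l` belongs above `u`, or does not exist. -/
def NextAbove {V : Type*} (r : V → V → Prop) (L : V → ℕ) (u : V) (l : List V) : Prop :=
  ∀ y ∈ l.head?, Above r L u y

/-- Inserting `u` between `l₁` and `l₂` is exceptional if the step from `l₁` to `l₂` crosses the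
place of `u` upwards although it is a descent, or downwards although it is not. -/
def Exceptional {V : Type*} (r : V → V → Prop) (L : V → ℕ) (u : V) (p : List V × List V) : Prop :=
  (¬ PrevAbove r L u p.1 ∧ NextAbove r L u p.2 ∧ joinCost (descent r L) p.1 p.2 = 1) ∨
    (PrevAbove r L u p.1 ∧ ¬ NextAbove r L u p.2 ∧ joinCost (descent r L) p.1 p.2 = 0)

/-- The number of descents of the two pieces of a linear extension cut at a vertex. -/
noncomputable def cutCost {V : Type*} (r : V → V → Prop) (L : V → ℕ) (p : List V × List V) : ℕ :=
  listCost (descent r L) p.1 + listCost (descent r L) p.2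

open scoped Classical in
/-- The exceptional cuts at `u`. -/
noncomputable def exceptionalCuts {V : Type*} [Finite V] (r : V → V → Prop) (L : V → ℕ) (u : V) :
    Finset (List V × List V) :=
  {p ∈ cuts r u | Exceptional r L u p}

theorem IsLinExt.not_rel_left {V : Type*} {r : V → V → Prop} {u : V} {l₁ l₂ : List V}
    (h : IsLinExt r (l₁ ++ u :: l₂)) {x : V} (hx : x ∈ l₁) : ¬ r u x :=
  (List.pairwise_append.1 h.pairwise).2.2 x hx u (by simp)

theorem IsLinExt.not_rel_right {V : Type*} {r : V → V → Prop} {u : V} {l₁ l₂ : List V}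
    (h : IsLinExt r (l₁ ++ u :: l₂)) {y : V} (hy : y ∈ l₂) : ¬ r y u :=
  (List.pairwise_cons.1 (List.pairwise_append.1 h.pairwise).2.1).1 y hy

theorem IsLinExt.ne_left {V : Type*} {r : V → V → Prop} {u : V} {l₁ l₂ : List V}
    (h : IsLinExt r (l₁ ++ u :: l₂)) {x : V} (hx : x ∈ l₁) : x ≠ u :=
  (List.nodup_append.1 h.nodup).2.2 x hx u (by simp)

theorem IsLinExt.ne_right {V : Type*} {r : V → V → Prop} {u : V} {l₁ l₂ : List V}
    (h : IsLinExt r (l₁ ++ u :: l₂)) {y : V} (hy : y ∈ l₂) : y ≠ u := by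
  rintro rfl
  exact (List.nodup_cons.1 (List.nodup_append.1 h.nodup).2.1).1 hy

open scoped Classical in
theorem joinCost_prev {V : Type*} {r : V → V → Prop} {L : V → ℕ} {u : V} {l₁ l₂ : List V}
    (h : IsLinExt r (l₁ ++ u :: l₂)) (m : List V) :
    joinCost (descent r L) l₁ (u :: m) = if PrevAbove r L u l₁ then 1 else 0 := by
  rcases List.eq_nil_or_concat' l₁ with rfl | ⟨l, x, rfl⟩
  · simp [joinCost, PrevAbove]
  · have := h.not_rel_left (x := x) (by simp)
    simp [joinCost, PrevAbove, Above, descent, this]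

open scoped Classical in
theorem joinCost_next {V : Type*} {r : V → V → Prop} {L : V → ℕ} (hL : L.Injective) {u : V}
    {l₁ l₂ : List V} (h : IsLinExt r (l₁ ++ u :: l₂)) :
    joinCost (descent r L) [u] l₂ = if NextAbove r L u l₂ then 0 else 1 := by
  cases l₂ with
  | nil => simp [joinCost, NextAbove]
  | cons y l =>
    have h1 := h.not_rel_right (y := y) (by simp)
    have h2 := hL.ne (h.ne_right (y := y) (by simp))
    have h3 : ¬ (L y < L u ∧ ¬ r u y) ↔ (r u y ∨ L u < L y) := by
      by_cases h4 : r u y <;> (simp [h4]; try omega)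
    by_cases h5 : L y < L u ∧ ¬ r u y
    · simp [joinCost, NextAbove, Above, descent, h1, h5, h5.1.le]
    · simp [joinCost, NextAbove, Above, descent, h1, h5, h3.1 h5]

/-- How a single linear extension contributes: up to a term independent of the label of `u`, a
crossing of the place of `u` is counted with its sign and exceptional crossings contribute a
multiple of `(1 - X) ^ 2`. -/
theorem pow_listCost_cut {V : Type*} {r : V → V → Prop} {L : V → ℕ} (hL : L.Injective) {u : V}
    {p : List V × List V} (h : IsLinExt r (p.1 ++ u :: p.2))
    [Decidable (PrevAbove r L u p.1)] [Decidable (NextAbove r L u p.2)]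
    [Decidable (Exceptional r L u p)] :
    (X : ℤ[X]) ^ listCost (descent r L) (p.1 ++ u :: p.2)
      = X * X ^ cutCost r L p
        + (1 - X) * ((if NextAbove r L u p.2 then X ^ listCost (descent r L) (p.1 ++ p.2) else 0)
          - (if PrevAbove r L u p.1 then X ^ listCost (descent r L) (p.1 ++ p.2) else 0))
        + (1 - X) ^ 2 * (if Exceptional r L u p then X ^ cutCost r L p else 0) := by
  obtain ⟨l₁, l₂⟩ := p
  have h1 : listCost (descent r L) (u :: l₂)
      = joinCost (descent r L) [u] l₂ + listCost (descent r L) l₂ := by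
    have := listCost_append (descent r L) [u] l₂
    simpa [listCost] using this
  simp only at h
  simp only [listCost_append, h1, joinCost_prev h, joinCost_next hL h, cutCost, Exceptional]
  have hj := joinCost_le_one r L l₁ l₂
  obtain hj | hj : joinCost (descent r L) l₁ l₂ = 0 ∨ joinCost (descent r L) l₁ l₂ = 1 := by omega
  all_goals
    by_cases hp : PrevAbove r L u l₁ <;> by_cases hq : NextAbove r L u l₂ <;>
      simp [hp, hq, hj] <;> ring

/-! ### Moving one label -/

theorem IsLinExt.swap {V : Type*} {r : V → V → Prop} {u v : V} {l₁ l₂ : List V}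
    (h : IsLinExt r (l₁ ++ u :: v :: l₂)) (huv : ¬ r u v) : IsLinExt r (l₁ ++ v :: u :: l₂) := by
  have hp : (l₁ ++ v :: u :: l₂).Perm (l₁ ++ u :: v :: l₂) :=
    (List.Perm.swap u v l₂).append_left l₁
  refine ⟨hp.nodup_iff.2 h.nodup, fun x => hp.mem_iff.2 (h.mem x), ?_⟩
  have := h.pairwise
  simp only [List.pairwise_append, List.pairwise_cons, List.mem_cons] at this ⊢
  grind

open scoped Classical in
/-- The signed count of the crossings of the place of `u` telescopes: moving `u` past an unrelated
right neighbour turns a step up after `u` into a step up before `u`, and only the linear extensions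
with `u` in its last possible place are left. -/
theorem sum_nextAbove_sub_prevAbove {V R : Type*} [Finite V] [AddCommGroup R] (r : V → V → Prop)
    (L : V → ℕ) (u : V) (f : List V → R) :
    ∑ p ∈ cuts r u, ((if NextAbove r L u p.2 then f (p.1 ++ p.2) else 0)
        - (if PrevAbove r L u p.1 then f (p.1 ++ p.2) else 0))
      = ∑ p ∈ cuts r u with ∀ y ∈ p.2.head?, r u y, f (p.1 ++ p.2) := by
  rw [Finset.sum_sub_distrib, ← Finset.sum_filter, ← Finset.sum_filter, sub_eq_iff_eq_add,
    ← Finset.sum_filter_add_sum_filter_not _ (fun p => ∀ y ∈ p.2.head?, r u y),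
    Finset.filter_filter, Finset.filter_filter]
  congr 1
  · refine Finset.sum_congr (Finset.filter_congr fun p _ => ⟨fun h => h.2, fun h => ⟨?_, h⟩⟩)
      fun _ _ => rfl
    exact fun y hy => Or.inl (h y hy)
  · have key : ∀ p ∈ cuts r u, NextAbove r L u p.2 ∧ (¬ ∀ y ∈ p.2.head?, r u y) →
        ∃ y l, p.2 = y :: l ∧ ¬ r u y ∧ ¬ r y u ∧ L u < L y := by
      rintro ⟨l₁, l₂⟩ hp ⟨h1, h2⟩
      cases l₂ with
      | nil => simp at h2
      | cons y l =>
        simp only [List.head?_cons, Option.mem_def, Option.some.injEq, forall_eq'] at h2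
        have h3 := h1 y (by simp)
        exact ⟨y, l, rfl, h2, (h3.resolve_left h2).2, (h3.resolve_left h2).1⟩
    refine Finset.sum_bij (fun p _ => (p.1 ++ p.2.head?.toList, p.2.tail)) ?_ ?_ ?_ ?_
    · intro p hp
      rw [Finset.mem_filter] at hp ⊢
      obtain ⟨y, l, h1, h2, h3, h4⟩ := key p hp.1 hp.2
      have h5 := mem_cuts.1 hp.1
      rw [h1] at h5
      refine ⟨mem_cuts.2 ?_, y, by simp [h1], Or.inr ⟨h4, h3⟩⟩
      simpa [h1] using h5.swap h2
    · intro p hp q hq he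
      rw [Finset.mem_filter] at hp hq
      obtain ⟨y, l, h1, -⟩ := key p hp.1 hp.2
      obtain ⟨z, m, h2, -⟩ := key q hq.1 hq.2
      simp only [h1, h2, List.head?_cons, Option.toList_some, List.tail_cons, Prod.mk.injEq] at he
      obtain ⟨h3, h4⟩ := List.append_inj' he.1 rfl
      simp only [List.cons.injEq, and_true] at h4
      exact Prod.ext h3 (by rw [h1, h2, h4, he.2])
    · rintro ⟨l₁, l₂⟩ hp
      rw [Finset.mem_filter] at hp
      obtain ⟨hp, x, hx, hx'⟩ := hp
      obtain ⟨l, rfl⟩ : ∃ l, l₁ = l ++ [x] :=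
        ⟨l₁.dropLast, (List.dropLast_append_getLast? x hx).symm⟩
      have h1 := mem_cuts.1 hp
      have h2 : ¬ r u x := h1.not_rel_left (by simp)
      have h3 := hx'.resolve_left h2
      refine ⟨(l, x :: l₂), ?_, by simp⟩
      rw [Finset.mem_filter]
      refine ⟨mem_cuts.2 (IsLinExt.swap (by simpa using h1) h3.2), ?_, ?_⟩
      · intro y hy
        obtain rfl : x = y := by simpa using hy
        exact hx'
      · simpa using h2
    · intro p hp
      rw [Finset.mem_filter] at hp
      obtain ⟨y, l, h1, -⟩ := key p hp.1 hp.2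
      simp [h1]

open scoped Classical in
/-- Only the last of the three terms depends on the label of `u`. -/
theorem descentPoly_eq {V : Type*} [Finite V] (r : V → V → Prop) (L : V → ℕ) (u : V)
    (hL : L.Injective) :
    descentPoly r L = ∑ p ∈ cuts r u, X * X ^ cutCost r L p
      + (1 - X) * ∑ p ∈ cuts r u with ∀ y ∈ p.2.head?, r u y,
          X ^ listCost (descent r L) (p.1 ++ p.2)
      + (1 - X) ^ 2 * ∑ p ∈ exceptionalCuts r L u, X ^ cutCost r L p := by
  rw [descentPoly, sum_linExts r u,
    Finset.sum_congr rfl fun p hp => pow_listCost_cut hL (mem_cuts.1 hp),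
    Finset.sum_add_distrib, Finset.sum_add_distrib, ← Finset.mul_sum _ _ (1 - X),
    ← Finset.mul_sum _ _ ((1 - X) ^ 2),
    sum_nextAbove_sub_prevAbove r L u fun l => (X : ℤ[X]) ^ listCost (descent r L) l,
    ← Finset.sum_filter]
  rfl

/-- Moving the label of a single element `u` changes the descent polynomial by a multiple of
`(1 - X) ^ 2` that is determined by the exceptional cuts at `u`. -/
theorem descentPoly_sub {V : Type*} [Finite V] (r : V → V → Prop) {L L' : V → ℕ} (u : V)
    (hL : L.Injective) (hL' : L'.Injective)
    (h : ∀ v, v ≠ u → L v = L' v) :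
    descentPoly r L - descentPoly r L'
      = (1 - X) ^ 2 * (∑ p ∈ exceptionalCuts r L u, X ^ cutCost r L p
        - ∑ p ∈ exceptionalCuts r L' u, X ^ cutCost r L' p) := by
  classical
  have h1 : ∀ l : List V, (∀ x ∈ l, x ≠ u) →
      listCost (descent r L) l = listCost (descent r L') l := by
    refine fun l hl => listCost_congr fun a ha b hb => ?_
    rw [descent, descent, h a (hl a ha), h b (hl b hb)]
  have h2 : ∀ p ∈ cuts r u, cutCost r L p = cutCost r L' p ∧
      listCost (descent r L) (p.1 ++ p.2) = listCost (descent r L') (p.1 ++ p.2) := by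
    intro p hp
    have h3 : ∀ x ∈ p.1, x ≠ u := fun x hx => (mem_cuts.1 hp).ne_left hx
    have h4 : ∀ x ∈ p.2, x ≠ u := fun x hx => (mem_cuts.1 hp).ne_right hx
    refine ⟨?_, h1 _ fun x hx => (List.mem_append.1 hx).elim (h3 x) (h4 x)⟩
    rw [cutCost, cutCost, h1 _ h3, h1 _ h4]
  rw [descentPoly_eq r L u hL, descentPoly_eq r L' u hL',
    Finset.sum_congr (s₁ := cuts r u) rfl fun p hp => by rw [(h2 p hp).1],
    Finset.sum_congr (s₁ := Finset.filter _ (cuts r u)) rfl fun p hp => by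
      rw [(h2 p (Finset.mem_filter.1 hp).1).2]]
  ring

/-! ### Exceptional cuts and crossed relations -/

/-- The relation `r c a` crosses `b`: the labels satisfy `a < b < c`, and `b` is unrelated to `a`
and to `c`. -/
structure Crossing {V : Type*} (r : V → V → Prop) (L : V → ℕ) (a b c : V) : Prop where
  lt₁ : L a < L b
  lt₂ : L b < L c
  rel : r c a
  not_ab : ¬ r a b
  not_ba : ¬ r b a
  not_bc : ¬ r b c
  not_cb : ¬ r c b

theorem Exceptional.exists_eq {V : Type*} {r : V → V → Prop} {L : V → ℕ} {u : V}
    {l₁ l₂ : List V} (h : Exceptional r L u (l₁, l₂)) :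
    ∃ m₁ x y m₂, l₁ = m₁ ++ [x] ∧ l₂ = y :: m₂ := by
  rcases List.eq_nil_or_concat' l₁ with rfl | ⟨m₁, x, rfl⟩
  · simp [Exceptional, joinCost_nil_left, PrevAbove] at h
  · cases l₂ with
    | nil => simp [Exceptional, joinCost_nil_right, NextAbove] at h
    | cons y m₂ => exact ⟨m₁, x, y, m₂, rfl, rfl⟩

theorem exceptional_iff {V : Type*} {r : V → V → Prop} {L : V → ℕ} {u x y : V}
    {l₁ l₂ : List V} : Exceptional r L u (l₁ ++ [x], y :: l₂) ↔
      (¬ Above r L u x ∧ Above r L u y ∧ L y < L x ∧ ¬ r x y) ∨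
        (Above r L u x ∧ ¬ Above r L u y ∧ ¬ (L y < L x ∧ ¬ r x y)) := by
  simp [Exceptional, PrevAbove, NextAbove, joinCost, descent]

theorem cutCost_lt_of_exceptional {V : Type*} [Fintype V] {r : V → V → Prop} {L : V → ℕ} {u : V}
    {p : List V × List V} (hp : p ∈ exceptionalCuts r L u) :
    cutCost r L p < Fintype.card V - 2 := by
  classical
  rw [exceptionalCuts, Finset.mem_filter, mem_cuts] at hp
  obtain ⟨l₁, l₂⟩ := p
  obtain ⟨m₁, x, y, m₂, rfl, rfl⟩ := hp.2.exists_eq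
  have h1 := listCost_lt (descent_le_one r L) (l := m₁ ++ [x]) (by simp)
  have h2 := listCost_lt (descent_le_one r L) (l := y :: m₂) (by simp)
  have h3 := List.Nodup.length_le_card hp.1.nodup
  simp only [cutCost, List.length_append, List.length_cons, List.length_nil] at h1 h2 h3 ⊢
  omega

/-- An exceptional cut at `u` comes from a crossing in which `u` takes part. -/
theorem Exceptional.exists_crossing {V : Type*} {r : V → V → Prop} {L : V → ℕ} {u : V}
    (htrans : ∀ a b c, r a b → r b c → r a c) (hL : L.Injective)
    {l₁ l₂ : List V} (hp : IsLinExt r (l₁ ++ u :: l₂)) (h : Exceptional r L u (l₁, l₂)) :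
    ∃ a b c, Crossing r L a b c ∧ (u = a ∨ u = b ∨ u = c) := by
  obtain ⟨m₁, x, y, m₂, rfl, rfl⟩ := h.exists_eq
  have h1 : ¬ r u x := hp.not_rel_left (by simp)
  have h2 : ¬ r y u := hp.not_rel_right (by simp)
  have h3 : ¬ r y x := by
    have := hp.pairwise
    simp only [List.pairwise_append, List.pairwise_cons, List.mem_cons, List.mem_append] at this
    grind
  have h4 : L x ≠ L u := hL.ne (hp.ne_left (by simp))
  have h5 : L y ≠ L u := hL.ne (hp.ne_right (by simp))
  have h6 := htrans x u y
  rw [exceptional_iff] at h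
  simp only [Above, h1, h2, false_or, not_false_eq_true, and_true] at h
  by_cases hxu : r x u
  · have huy : ¬ r u y := by grind
    have : Crossing r L u y x := by constructor <;> grind
    exact ⟨u, y, x, this, Or.inl rfl⟩
  · by_cases huy : r u y
    · have : Crossing r L y x u := by constructor <;> grind
      exact ⟨y, x, u, this, Or.inr (Or.inr rfl)⟩
    · have : Crossing r L y u x := by constructor <;> grind
      exact ⟨y, u, x, this, Or.inr (Or.inl rfl)⟩

/-- In a crossing with fixed middle element `b`, the relation `r c a` can be chosen to be a cover:
an intermediate element is unrelated to `b` and can replace `a` or `c`, according to its label. -/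
theorem Crossing.exists_cover {V : Type*} [Finite V] {r : V → V → Prop} [IsStrictOrder V r]
    {L : V → ℕ} (hL : L.Injective) {a b c : V} (h : Crossing r L a b c) :
    ∃ a' c', Crossing r L a' b c' ∧ ∀ z, r c' z → ¬ r z a' := by
  have htrans : ∀ {x y z}, r x y → r y z → r x z := fun h1 h2 => _root_.trans h1 h2
  have hirr : ∀ x, ¬ r x x := irrefl
  induction hk : {z | r c z ∧ r z a}.ncard using Nat.strong_induction_on generalizing a c with
  | _ k ih =>
    by_cases hz : ∃ z, r c z ∧ r z a
    · obtain ⟨z, hcz, hza⟩ := hz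
      have h1 : ¬ r b z := fun h' => h.not_ba (htrans h' hza)
      have h2 : ¬ r z b := fun h' => h.not_cb (htrans hcz h')
      have h3 : L z ≠ L b := hL.ne (by rintro rfl; exact h.not_ba hza)
      rcases lt_or_gt_of_ne h3 with h4 | h4
      · refine ih _ (hk ▸ ?_) ⟨h4, h.lt₂, hcz, h2, h1, h.not_bc, h.not_cb⟩ rfl
        refine Set.ncard_lt_ncard ((Set.ssubset_iff_of_subset ?_).2 ⟨z, ⟨hcz, hza⟩, ?_⟩)
        · exact fun w hw => ⟨hw.1, htrans hw.2 hza⟩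
        · exact fun hw => hirr z hw.2
      · refine ih _ (hk ▸ ?_) ⟨h.lt₁, h4, hza, h.not_ab, h.not_ba, h1, h2⟩ rfl
        refine Set.ncard_lt_ncard ((Set.ssubset_iff_of_subset ?_).2 ⟨z, ⟨hcz, hza⟩, ?_⟩)
        · exact fun w hw => ⟨htrans hcz hw.1, hw.2⟩
        · exact fun hw => hirr z hw.1
    · push Not at hz
      exact ⟨a, c, h, hz⟩

theorem exists_list_pairwise {V : Type*} [Finite V] (r : V → V → Prop) [IsStrictOrder V r]
    (s : Finset V) :
    ∃ l : List V, l.Nodup ∧ (∀ v, v ∈ l ↔ v ∈ s) ∧ l.Pairwise fun a b => ¬ r b a := by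
  classical
  induction s using Finset.strongInduction with
  | H s ih =>
    rcases s.eq_empty_or_nonempty with rfl | hs
    · exact ⟨[], by simp⟩
    · obtain ⟨m, hm, hmin⟩ := (Finite.wellFounded_of_trans_of_irrefl r).has_min (s : Set V) hs
      obtain ⟨l, h1, h2, h3⟩ := ih _ (Finset.erase_ssubset hm)
      refine ⟨m :: l, List.nodup_cons.2 ⟨by simp [h2], h1⟩, fun v => ?_,
        List.pairwise_cons.2 ⟨fun v hv => hmin v ?_, h3⟩⟩
      · by_cases hv : v = m
        · simp [hv, Finset.mem_coe.1 hm]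
        · simp [h2, hv]
      · exact Finset.mem_of_mem_erase ((h2 v).1 hv)

/-- A convex triple, in an order compatible with `r`, is a block of some linear extension. -/
theorem exists_isLinExt_block {V : Type*} [Finite V] (r : V → V → Prop) [IsStrictOrder V r]
    {x y z : V} (hxy : x ≠ y) (hxz : x ≠ z) (hyz : y ≠ z)
    (hyx : ¬ r y x) (hzx : ¬ r z x) (hzy : ¬ r z y)
    (hconv : ∀ v w w', (w = x ∨ w = y ∨ w = z) → (w' = x ∨ w' = y ∨ w' = z) → r w v → r v w' →
      v = x ∨ v = y ∨ v = z) :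
    ∃ l₁ l₂, IsLinExt r (l₁ ++ x :: y :: z :: l₂) := by
  classical
  have := Fintype.ofFinite V
  have htrans : ∀ {x y z}, r x y → r y z → r x z := fun h1 h2 => _root_.trans h1 h2
  have hirr : ∀ x, ¬ r x x := irrefl
  -- The elements below the triple come first, those not below it come last.
  obtain ⟨l₁, h1, h2, h3⟩ := exists_list_pairwise r
    (Finset.univ.filter fun v => ¬ (v = x ∨ v = y ∨ v = z) ∧ (r v x ∨ r v y ∨ r v z))
  obtain ⟨l₂, h4, h5, h6⟩ := exists_list_pairwise r
    (Finset.univ.filter fun v => ¬ (v = x ∨ v = y ∨ v = z) ∧ ¬ (r v x ∨ r v y ∨ r v z))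
  simp only [Finset.mem_filter, Finset.mem_univ, true_and] at h2 h5
  refine ⟨l₁, l₂, ?_, fun v => ?_, ?_⟩
  · simp only [List.nodup_append, List.nodup_cons, List.mem_cons]
    grind
  · simp only [List.mem_append, List.mem_cons, h2, h5]
    tauto
  · simp only [List.pairwise_append, List.pairwise_cons, List.mem_cons]
    refine ⟨h3, ⟨?_, ?_, ?_, h6⟩, ?_⟩
    · rintro v (rfl | rfl | hv)
      · exact hyx
      · exact hzx
      · exact fun h => ((h5 v).1 hv).2 (Or.inl h)
    · rintro v (rfl | hv)
      · exact hzy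
      · exact fun h => ((h5 v).1 hv).2 (Or.inr (Or.inl h))
    · exact fun v hv h => ((h5 v).1 hv).2 (Or.inr (Or.inr h))
    · intro v hv w hw hwv
      obtain ⟨hv1, hv2⟩ := (h2 v).1 hv
      have hw' : (w = x ∨ w = y ∨ w = z) ∨ w ∈ l₂ := by tauto
      rcases hw' with hw' | hw'
      · rcases hv2 with h | h | h
        · exact hv1 (hconv v w x hw' (by simp) hwv h)
        · exact hv1 (hconv v w y hw' (by simp) hwv h)
        · exact hv1 (hconv v w z hw' (by simp) hwv h)
      · refine ((h5 w).1 hw').2 ?_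
        rcases hv2 with h | h | h
        · exact Or.inl (htrans hwv h)
        · exact Or.inr (Or.inl (htrans hwv h))
        · exact Or.inr (Or.inr (htrans hwv h))

theorem exceptionalCuts_nonempty_of_block {V : Type*} [Finite V] {r : V → V → Prop} {L : V → ℕ}
    {u x y : V} (hb : ∃ l₁ l₂, IsLinExt r (l₁ ++ x :: u :: y :: l₂))
    (h : (¬ Above r L u x ∧ Above r L u y ∧ L y < L x ∧ ¬ r x y) ∨
        (Above r L u x ∧ ¬ Above r L u y ∧ ¬ (L y < L x ∧ ¬ r x y))) :
    (exceptionalCuts r L u).Nonempty := by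
  classical
  obtain ⟨l₁, l₂, hl⟩ := hb
  refine ⟨(l₁ ++ [x], y :: l₂), ?_⟩
  rw [exceptionalCuts, Finset.mem_filter, mem_cuts, exceptional_iff]
  exact ⟨by simpa using hl, h⟩

/-- Every element of a crossing whose relation is a cover has an exceptional cut. -/
theorem Crossing.exceptionalCuts_nonempty {V : Type*} [Finite V] {r : V → V → Prop}
    [IsStrictOrder V r] {L : V → ℕ} {a b c u : V} (h : Crossing r L a b c)
    (hcov : ∀ z, r c z → ¬ r z a) (hu : u = a ∨ u = b ∨ u = c) :
    (exceptionalCuts r L u).Nonempty := by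
  have htrans : ∀ x y z, r x y → r y z → r x z := fun _ _ _ h1 h2 => _root_.trans h1 h2
  have hirr : ∀ x, ¬ r x x := irrefl
  obtain ⟨h1, h2, h3, h4, h5, h6, h7⟩ := h
  have h8 : ¬ r a c := fun h => hirr _ (htrans _ _ _ h h3)
  have hab : a ≠ b := by rintro rfl; omega
  have hbc : b ≠ c := by rintro rfl; omega
  have hac : a ≠ c := by rintro rfl; omega
  have hconv : ∀ v w w', (w = a ∨ w = b ∨ w = c) → (w' = a ∨ w' = b ∨ w' = c) → r w v → r v w' →
      v = a ∨ v = b ∨ v = c := by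
    intro v w w' hw hw' h h'
    have h9 := htrans _ _ _ h h'
    have h10 := hcov v
    rcases hw with rfl | rfl | rfl <;> rcases hw' with rfl | rfl | rfl <;>
      first | exact absurd h9 (hirr _) | exact absurd h9 ‹_› | exact absurd h' (h10 h)
  rcases hu with rfl | rfl | rfl
  · refine exceptionalCuts_nonempty_of_block (x := c) (y := b) (exists_isLinExt_block r hac.symm
      hbc.symm hab h8 h6 h5 ?_) (Or.inl ?_)
    · grind
    · simp only [Above]; grind
  · refine exceptionalCuts_nonempty_of_block (x := c) (y := a) (exists_isLinExt_block r hbc.symm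
      hac.symm hab.symm h6 h8 h4 ?_) (Or.inr ?_)
    · grind
    · simp only [Above]; grind
  · refine exceptionalCuts_nonempty_of_block (x := b) (y := a) (exists_isLinExt_block r hbc
      hab.symm hac.symm h7 h4 h8 ?_) (Or.inl ?_)
    · grind
    · simp only [Above]; grind

/-! ### Moving all labels to a natural labelling -/

/-- The labelling that agrees with the natural labelling `ν`, shifted above all values of `L`, on
the elements with `k ≤ ν v`, and with `L` on the others. -/
def mixedLabel {V : Type*} {N : ℕ} (ν : V ≃ Fin N) (L : V → ℕ) (k : ℕ) (v : V) : ℕ :=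
  if k ≤ ν v then N + ν v else L v

theorem mixedLabel_injective {V : Type*} {N : ℕ} (ν : V ≃ Fin N) {L : V → ℕ} (hL : L.Injective)
    (hLN : ∀ v, L v < N) (k : ℕ) : (mixedLabel ν L k).Injective := by
  intro v w h
  have h1 := hLN v
  have h2 := hLN w
  unfold mixedLabel at h
  split_ifs at h
  · exact ν.injective (Fin.ext (by omega))
  · omega
  · omega
  · exact hL h

/-- The labelling `L` is turned into the natural labelling `ν` by moving the elements above all
others, in decreasing order of `ν`. If no move ends with exceptional cuts at the moved element, then
the descent polynomials differ by the contributions of the exceptional cuts before each move. -/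
theorem descentPoly_sub_natural {V : Type*} [Fintype V] {r : V → V → Prop} {N : ℕ} (ν : V ≃ Fin N)
    {L : V → ℕ} (hL : L.Injective) (hLN : ∀ v, L v < N)
    (hE : ∀ u, exceptionalCuts r (mixedLabel ν L (ν u)) u = ∅) :
    descentPoly r L - descentPoly r (fun v => (ν v : ℕ))
      = (1 - X) ^ 2 * ∑ u, ∑ p ∈ exceptionalCuts r (mixedLabel ν L (ν u + 1)) u,
          X ^ cutCost r (mixedLabel ν L (ν u + 1)) p := by
  have h0 : descent r (mixedLabel ν L 0) = descent r fun v => (ν v : ℕ) := by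
    funext a b
    have : mixedLabel ν L 0 b < mixedLabel ν L 0 a ↔ (ν b : ℕ) < ν a := by simp [mixedLabel]
    classical exact if_congr (and_congr_left' this) rfl rfl
  have h1 : descentPoly r (mixedLabel ν L N) = descentPoly r L := by
    congr 1
    funext v
    simp [mixedLabel]
  have h2 : descentPoly r (mixedLabel ν L 0) = descentPoly r fun v => (ν v : ℕ) := by
    rw [descentPoly, h0, descentPoly]
  rw [← h2, ← h1, ← Finset.sum_range_sub (fun k => descentPoly r (mixedLabel ν L k)),
    Finset.sum_range, ← ν.sum_comp, Finset.mul_sum]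
  refine Finset.sum_congr rfl fun u _ => ?_
  rw [descentPoly_sub r u (mixedLabel_injective ν hL hLN _) (mixedLabel_injective ν hL hLN _)
    (fun v hv => ?_), hE, Finset.sum_empty, sub_zero]
  have h3 : (ν v : ℕ) ≠ ν u := fun h => hv (ν.injective (Fin.ext h))
  have h4 : (ν u : ℕ) + 1 ≤ ν v ↔ (ν u : ℕ) ≤ ν v := by omega
  simp only [mixedLabel, h4]

/-- In a mixed labelling every crossing lies in the part labelled by `L`: the other part is
naturally labelled, closed upwards, and lies above. -/
theorem Crossing.of_mixedLabel {V : Type*} {r : V → V → Prop} {N : ℕ} {ν : V ≃ Fin N}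
    (hν : ∀ a b, r a b → ν a < ν b) {L : V → ℕ} (hLN : ∀ v, L v < N) {k : ℕ} {a b c : V}
    (h : Crossing r (mixedLabel ν L k) a b c) :
    Crossing r L a b c ∧ ν a < k ∧ ν b < k ∧ ν c < k := by
  obtain ⟨h1, h2, h3, h4, h6, h7, h8⟩ := h
  have h5 : (ν c : ℕ) < ν a := hν _ _ h3
  have ha := hLN a
  have hb := hLN b
  have hc := hLN c
  unfold mixedLabel at h1 h2
  split_ifs at h1 h2 <;> first | omega | skip
  exact ⟨⟨h1, h2, h3, h4, h6, h7, h8⟩, by omega, by omega, by omega⟩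

theorem Crossing.mixedLabel {V : Type*} {r : V → V → Prop} {N : ℕ} {ν : V ≃ Fin N}
    {L : V → ℕ} {k : ℕ} {a b c : V} (h : Crossing r L a b c)
    (ha : ν a < k) (hb : ν b < k) (hc : ν c < k) : Crossing r (mixedLabel ν L k) a b c := by
  refine { h with lt₁ := ?_, lt₂ := ?_ }
  · simpa [LabelledOrder.mixedLabel, ha.not_ge, hb.not_ge] using h.lt₁
  · simpa [LabelledOrder.mixedLabel, hb.not_ge, hc.not_ge] using h.lt₂

/-- Once `u` has been moved, it takes part in no crossing, hence has no exceptional cut. -/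
theorem exceptionalCuts_mixedLabel_eq_empty {V : Type*} [Finite V] {r : V → V → Prop}
    [IsStrictOrder V r] {N : ℕ} {ν : V ≃ Fin N} (hν : ∀ a b, r a b → ν a < ν b) {L : V → ℕ}
    (hL : L.Injective) (hLN : ∀ v, L v < N) (u : V) :
    exceptionalCuts r (mixedLabel ν L (ν u)) u = ∅ := by
  classical
  rw [Finset.eq_empty_iff_forall_notMem]
  intro p hp
  rw [exceptionalCuts, Finset.mem_filter, mem_cuts] at hp
  obtain ⟨a, b, c, h, hu⟩ := hp.2.exists_crossing (fun _ _ _ h1 h2 => _root_.trans h1 h2)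
    (mixedLabel_injective ν hL hLN _) hp.1
  obtain ⟨-, ha, hb, hc⟩ := h.of_mixedLabel hν hLN
  rcases hu with rfl | rfl | rfl <;> omega

/-- Some move in the passage from `L` to the natural labelling `ν` has an exceptional cut if and
only if `L` has a crossing. -/
theorem exists_exceptionalCuts_nonempty_iff {V : Type*} [Finite V] {r : V → V → Prop}
    [IsStrictOrder V r] {N : ℕ} {ν : V ≃ Fin N} (hν : ∀ a b, r a b → ν a < ν b) {L : V → ℕ}
    (hL : L.Injective) (hLN : ∀ v, L v < N) :
    (∃ u, (exceptionalCuts r (mixedLabel ν L (ν u + 1)) u).Nonempty) ↔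
      ∃ a b c, Crossing r L a b c := by
  classical
  constructor
  · rintro ⟨u, p, hp⟩
    rw [exceptionalCuts, Finset.mem_filter, mem_cuts] at hp
    obtain ⟨a, b, c, h, -⟩ := hp.2.exists_crossing (fun _ _ _ h1 h2 => _root_.trans h1 h2)
      (mixedLabel_injective ν hL hLN _) hp.1
    exact ⟨a, b, c, (h.of_mixedLabel hν hLN).1⟩
  · rintro ⟨a, b, c, h⟩
    obtain ⟨a, c, h, hcov⟩ := h.exists_cover hL
    -- The first of the three elements to be moved is the one with the largest `ν`.
    obtain ⟨u, hu, ha, hb, hc⟩ : ∃ u, (u = a ∨ u = b ∨ u = c) ∧ ν a ≤ ν u ∧ ν b ≤ ν u ∧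
        ν c ≤ ν u := by
      have h1 : ν c < ν a := hν _ _ h.rel
      rcases le_total (ν a) (ν b) with h2 | h2
      · exact ⟨b, by simp, h2, le_rfl, h1.le.trans h2⟩
      · exact ⟨a, by simp, le_rfl, h2, h1.le⟩
    refine ⟨u, (h.mixedLabel ?_ ?_ ?_).exceptionalCuts_nonempty hcov hu⟩ <;>
      exact Nat.lt_succ_of_le ‹_›

/-! ### Orderings as permutations -/

theorem exists_ofFn_eq {n : ℕ} {r : Fin n → Fin n → Prop} {l : List (Fin n)} (h : IsLinExt r l) :
    ∃ π : Equiv.Perm (Fin n), List.ofFn π = l := by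
  have hlen : l.length = n := by
    rw [← List.toFinset_card_of_nodup h.nodup,
      Finset.eq_univ_iff_forall.2 fun v => List.mem_toFinset.2 (h.mem v), Finset.card_univ,
      Fintype.card_fin]
  refine ⟨Equiv.ofBijective (fun i => l.get (i.cast hlen.symm)) ?_, ?_⟩
  · refine Finite.injective_iff_bijective.1 fun i j hij => ?_
    simpa using List.nodup_iff_injective_get.1 h.nodup hij
  · refine List.ext_get (by simp [hlen]) fun i h1 h2 => ?_
    simp

theorem exists_natural_labelling {n : ℕ} (r : Fin n → Fin n → Prop) [IsStrictOrder (Fin n) r] :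
    ∃ ν : Equiv.Perm (Fin n), ∀ a b, r a b → ν a < ν b := by
  obtain ⟨l, h1, h2, h3⟩ := exists_list_pairwise r Finset.univ
  obtain ⟨π, rfl⟩ := exists_ofFn_eq ⟨h1, fun v => (h2 v).2 (Finset.mem_univ v), h3⟩
  refine ⟨π.symm, fun a b hab => ?_⟩
  rw [List.pairwise_ofFn] at h3
  rcases lt_trichotomy (π.symm a) (π.symm b) with h | h | h
  · exact h
  · exact absurd hab (by rw [π.symm.injective h]; exact irrefl b)
  · exact absurd hab (by simpa using h3 h)

end LabelledOrder

namespace AcyclicDigraph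

theorem isStrictOrder_transGen {V : Type*} {D : Digraph V} (hD : IsAcyclic D) :
    IsStrictOrder V (Relation.TransGen D.Adj) where
  irrefl := hD
  trans _ _ _ := Relation.TransGen.trans

theorem Respects.symm_lt {n : ℕ} {D : Digraph (Fin n)} {π : Equiv.Perm (Fin n)}
    (h : Respects D π) {a b : Fin n} (hab : Relation.TransGen D.Adj a b) :
    π.symm a < π.symm b := by
  induction hab with
  | single hab => exact h _ _ (by simpa using hab)
  | tail _ hab ih => exact ih.trans (h _ _ (by simpa using hab))

theorem respects_iff {n : ℕ} {D : Digraph (Fin n)} (hD : IsAcyclic D) (π : Equiv.Perm (Fin n)) :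
    Respects D π ↔ LabelledOrder.IsLinExt (Relation.TransGen D.Adj) (List.ofFn π) := by
  constructor
  · intro h
    refine ⟨List.nodup_ofFn.2 π.injective, fun v => List.mem_ofFn.2 (π.surjective v),
      List.pairwise_ofFn.2 fun i j hij hji => ?_⟩
    have := h.symm_lt hji
    simp only [Equiv.symm_apply_apply] at this
    exact this.asymm hij
  · intro h i j hij
    by_contra hlt
    rcases (not_lt.1 hlt).lt_or_eq with hlt | rfl
    · exact List.pairwise_ofFn.1 h.pairwise hlt (Relation.TransGen.single hij)
    · exact hD _ (Relation.TransGen.single hij)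

open scoped Classical in
/-- The `D`-respecting orderings, written as lists, are the linear extensions. -/
theorem sum_respects {n : ℕ} {D : Digraph (Fin n)} (hD : IsAcyclic D) {R : Type*}
    [AddCommMonoid R] (f : List (Fin n) → R) :
    ∑ π : Equiv.Perm (Fin n) with Respects D π, f (List.ofFn π)
      = ∑ l ∈ LabelledOrder.linExts (Relation.TransGen D.Adj), f l := by
  refine Finset.sum_bij (fun π _ => List.ofFn π) (fun π hπ => ?_) (fun π _ θ _ h => ?_)
    (fun l hl => ?_) fun _ _ => rfl
  · rw [LabelledOrder.mem_linExts, ← respects_iff hD]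
    exact (Finset.mem_filter.1 hπ).2
  · exact Equiv.ext fun i => congrFun (List.ofFn_injective h) i
  · rw [LabelledOrder.mem_linExts] at hl
    obtain ⟨π, rfl⟩ := LabelledOrder.exists_ofFn_eq hl
    exact ⟨π, by simpa [respects_iff hD] using hl, rfl⟩

/-- Consecutive entries of a `D`-respecting ordering are related only if they form an arc, so that
`δ_D` counts the steps that are not descents. -/
theorem deltaSum_add_listCost {k : ℕ} {D : Digraph (Fin (k + 1))}
    {π : Equiv.Perm (Fin (k + 1))} (h : Respects D π) :
    deltaSum D π + LabelledOrder.listCost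
      (LabelledOrder.descent (Relation.TransGen D.Adj) Fin.val) (List.ofFn π) = k := by
  classical
  have h1 : deltaSum D π = ∑ i : Fin k, delta D (π i.castSucc) (π i.succ) := rfl
  rw [h1, LabelledOrder.listCost_ofFn, ← Finset.sum_add_distrib]
  have h2 : ∀ i : Fin k, delta D (π i.castSucc) (π i.succ) + LabelledOrder.descent
      (Relation.TransGen D.Adj) Fin.val (π i.castSucc) (π i.succ) = 1 := by
    intro i
    have h3 : Relation.TransGen D.Adj (π i.castSucc) (π i.succ) ↔
        D.Adj (π i.castSucc) (π i.succ) := by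
      refine ⟨fun h4 => ?_, .single⟩
      rcases Relation.TransGen.head'_iff.1 h4 with ⟨z, h5, h6⟩
      rcases Relation.reflTransGen_iff_eq_or_transGen.1 h6 with h7 | h7
      · rwa [h7]
      · have h8 := h.symm_lt (.single h5)
        have h9 := h.symm_lt h7
        simp only [Equiv.symm_apply_apply, Fin.lt_def, Fin.val_castSucc, Fin.val_succ] at h8 h9
        omega
    have h4 : (π i.castSucc : ℕ) ≠ π i.succ := by
      intro h5
      have := π.injective (Fin.ext h5)
      simp [Fin.ext_iff] at this
    simp only [delta, LabelledOrder.descent, h3, Fin.lt_def]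
    by_cases h5 : D.Adj (π i.castSucc) (π i.succ)
    · simp [h5]
    · rcases lt_or_gt_of_ne h4 with h6 | h6 <;> simp [h5, h6, h6.not_gt]
  rw [Finset.sum_congr rfl fun i _ => h2 i]
  simp

end AcyclicDigraph

namespace LabelledOrder

/-! ### Order polynomials through natural labellings -/

/-- The number of ascents of `w` at positions before `i`. -/
def ascentsBefore {k : ℕ} (w : Fin (k + 1) → ℕ) (i : Fin (k + 1)) : ℕ :=
  (Finset.univ.filter fun j : Fin k => j.castSucc < i ∧ w j.castSucc < w j.succ).card

theorem ascentsBefore_succ {k : ℕ} (w : Fin (k + 1) → ℕ) (i : Fin k) :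
    ascentsBefore w i.succ
      = ascentsBefore w i.castSucc + if w i.castSucc < w i.succ then 1 else 0 := by
  unfold ascentsBefore
  have h : ∀ j : Fin k, j.castSucc < i.succ ↔ j = i ∨ j.castSucc < i.castSucc := by
    intro j
    simp only [Fin.lt_def, Fin.ext_iff, Fin.val_castSucc, Fin.val_succ]
    omega
  split_ifs with hi
  · rw [← Finset.card_insert_of_notMem (a := i) (by simp)]
    congr 1
    ext j
    simp only [h, Finset.mem_filter, Finset.mem_univ, true_and, Finset.mem_insert]
    constructor
    · tauto
    · rintro (rfl | h1)
      · exact ⟨Or.inl rfl, hi⟩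
      · exact ⟨Or.inr h1.1, h1.2⟩
  · rw [add_zero]
    congr 1
    ext j
    simp only [h, Finset.mem_filter, Finset.mem_univ, true_and]
    constructor
    · rintro ⟨rfl | h1, h2⟩
      · exact absurd h2 hi
      · exact ⟨h1, h2⟩
    · tauto

theorem card_orderEmbedding_fin (n N : ℕ) : Nat.card (Fin n ↪o Fin N) = N.choose n := by
  rw [Nat.card_congr Set.powersetCard.ofFinEmbEquiv, Set.powersetCard.card, Nat.card_fin]

/-- The number of weakly increasing sequences that increase strictly at the descents of `w`:
adding to each entry the number of earlier ascents of `w` gives the strictly increasing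
sequences. -/
theorem card_strictMono_toLex {k m : ℕ} (w : Fin (k + 1) → ℕ) :
    Nat.card {s : Fin (k + 1) → Fin m // StrictMono fun i => toLex (s i, w i)}
      = (m + ascentsBefore w (Fin.last k)).choose (k + 1) := by
  rw [← card_orderEmbedding_fin]
  have hmono : Monotone (ascentsBefore w) :=
    Fin.monotone_iff_le_succ.2 fun i => by rw [ascentsBefore_succ]; omega
  have key : ∀ s : Fin (k + 1) → Fin m, (StrictMono fun i => toLex (s i, w i)) ↔
      StrictMono fun i => (s i : ℕ) + ascentsBefore w i := by
    intro s
    rw [Fin.strictMono_iff_lt_succ, Fin.strictMono_iff_lt_succ]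
    refine forall_congr' fun i => ?_
    rw [Prod.Lex.toLex_lt_toLex, ascentsBefore_succ]
    simp only [Fin.lt_def, Fin.ext_iff]
    split_ifs <;> omega
  have hle : ∀ {N : ℕ} (f : Fin (k + 1) ↪o Fin N) (i), ascentsBefore w i ≤ f i := by
    intro N f i
    induction i using Fin.induction with
    | zero => simp [ascentsBefore]
    | succ i ih =>
      have : (f i.castSucc : ℕ) < f i.succ := f.strictMono Fin.castSucc_lt_succ
      rw [ascentsBefore_succ]
      split_ifs <;> omega
  refine Nat.card_congr
    { toFun := fun s => OrderEmbedding.ofStrictMono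
        (fun i => ⟨s.1 i + ascentsBefore w i, by
          have := (s.1 i).isLt
          have := hmono (Fin.le_last i)
          omega⟩) fun i j hij => (key s.1).1 s.2 hij
      invFun := fun f => ⟨fun i => ⟨f i - ascentsBefore w i, ?_⟩, ?_⟩
      left_inv := fun s => Subtype.ext <| funext fun i => Fin.ext <| Nat.add_sub_cancel ..
      right_inv := fun f => RelEmbedding.ext fun i => Fin.ext <| Nat.sub_add_cancel (hle f i) }
  · have h1 : Monotone fun i => (f i : ℕ) - ascentsBefore w i := by
      refine Fin.monotone_iff_le_succ.2 fun i => ?_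
      have : (f i.castSucc : ℕ) < f i.succ := f.strictMono Fin.castSucc_lt_succ
      rw [ascentsBefore_succ]
      split_ifs <;> omega
    have h2 := h1 (Fin.le_last i)
    have h3 := hle f (Fin.last k)
    have h4 := (f (Fin.last k)).isLt
    simp only at h2
    omega
  · rw [key]
    intro i j hij
    have := hle f i
    have := hle f j
    have h1 : (f i : ℕ) < f j := f.strictMono hij
    simp only
    omega

end LabelledOrder

namespace AcyclicDigraph

/-- The ordering of the vertices by the values of `σ`, with ties broken by `ν`. -/
def sortBy {n m : ℕ} (ν : Equiv.Perm (Fin n)) (σ : Fin n → Fin m) : Equiv.Perm (Fin n) :=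
  (Tuple.sort (σ ∘ ν.symm)).trans ν.symm

theorem sortBy_eq_iff {n m : ℕ} {ν π : Equiv.Perm (Fin n)} {σ : Fin n → Fin m} :
    sortBy ν σ = π ↔ StrictMono fun i => toLex (σ (π i), (ν (π i) : ℕ)) := by
  have h1 : sortBy ν σ = π ↔ π.trans ν = Tuple.sort (σ ∘ ν.symm) := by
    constructor
    · rintro rfl
      ext i
      simp [sortBy]
    · intro h
      ext i
      simp [sortBy, ← h]
  rw [h1, Tuple.eq_sort_iff]
  simp only [StrictMono, Prod.Lex.toLex_lt_toLex, Function.comp_apply, Equiv.trans_apply,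
    Equiv.symm_apply_apply, Monotone, Fin.lt_def (a := ν _)]
  constructor
  · rintro ⟨h2, h3⟩ i j hij
    rcases (h2 hij.le).lt_or_eq with h4 | h4
    · exact Or.inl h4
    · exact Or.inr ⟨h4, h3 i j hij h4⟩
  · intro h
    refine ⟨fun i j hij => ?_, fun i j hij hs => ?_⟩
    · rcases hij.lt_or_eq with hij | rfl
      · rcases h hij with h2 | h2
        · exact h2.le
        · exact h2.1.le
      · exact le_rfl
    · rcases h hij with h2 | h2
      · exact absurd hs h2.ne
      · exact h2.2

theorem ascentsBefore_add_listCost {k : ℕ} {r : Fin (k + 1) → Fin (k + 1) → Prop}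
    {ν : Equiv.Perm (Fin (k + 1))} (hν : ∀ a b, r a b → ν a < ν b)
    (π : Equiv.Perm (Fin (k + 1))) :
    LabelledOrder.ascentsBefore (fun i => (ν (π i) : ℕ)) (Fin.last k)
      + LabelledOrder.listCost (LabelledOrder.descent r fun v => (ν v : ℕ)) (List.ofFn π) = k := by
  classical
  rw [LabelledOrder.listCost_ofFn, LabelledOrder.ascentsBefore, Finset.card_filter,
    ← Finset.sum_add_distrib]
  have h : ∀ i : Fin k, ((if i.castSucc < Fin.last k ∧
      (ν (π i.castSucc) : ℕ) < ν (π i.succ) then 1 else 0) + LabelledOrder.descent r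
        (fun v => (ν v : ℕ)) (π i.castSucc) (π i.succ)) = 1 := by
    intro i
    have h1 : (ν (π i.castSucc) : ℕ) ≠ ν (π i.succ) := by
      intro h2
      have := π.injective (ν.injective (Fin.ext h2))
      simp [Fin.ext_iff] at this
    have h2 : (ν (π i.succ) : ℕ) < ν (π i.castSucc) → ¬ r (π i.castSucc) (π i.succ) :=
      fun h3 h4 => (Fin.lt_def.1 (hν _ _ h4)).asymm h3
    simp only [LabelledOrder.descent, Fin.castSucc_lt_last, true_and]
    rcases lt_or_gt_of_ne h1 with h3 | h3
    · simp [h3, h3.not_gt]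
    · simp [h3, h3.not_gt, h2 h3]
  rw [Finset.sum_congr rfl fun i _ => h i]
  simp

open scoped Classical in
/-- Stanley's expansion of the order polynomial: with respect to a natural labelling, an
order-preserving map is an ordering together with a weakly increasing sequence that increases
strictly at the descents. -/
theorem count_closure {k : ℕ} {D : Digraph (Fin (k + 1))} (hD : IsAcyclic D)
    {ν : Equiv.Perm (Fin (k + 1))} (hν : ∀ a b, Relation.TransGen D.Adj a b → ν a < ν b) (m : ℕ) :
    OrderPoly.count (closure D hD) m
      = ∑ π : Equiv.Perm (Fin (k + 1)) with Respects D π,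
          (m + (k - LabelledOrder.listCost (LabelledOrder.descent (Relation.TransGen D.Adj)
            fun v => (ν v : ℕ)) (List.ofFn π))).choose (k + 1) := by
  have h1 : ∀ σ : Fin (k + 1) → Fin m, (∀ u v, Relation.ReflTransGen D.Adj u v → σ u ≤ σ v) →
      Respects D (sortBy ν σ) := by
    intro σ hσ i j hij
    have h2 := sortBy_eq_iff.1 (rfl : sortBy ν σ = sortBy ν σ)
    by_contra hlt
    have h3 := h2.monotone (not_lt.1 hlt)
    rw [Prod.Lex.toLex_le_toLex] at h3
    have h4 := hσ _ _ (.single hij)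
    have h5 := Fin.lt_def.1 (hν _ _ (.single hij))
    rcases h3 with h3 | h3
    · exact absurd h4 (not_le.2 h3)
    · exact absurd h5 (not_lt.2 h3.2)
  have h2 : ∀ π, Respects D π → ∀ σ : Fin (k + 1) → Fin m,
      ((∀ u v, Relation.ReflTransGen D.Adj u v → σ u ≤ σ v) ∧ sortBy ν σ = π ↔
        StrictMono fun i => toLex (σ (π i), (ν (π i) : ℕ))) := by
    intro π hπ σ
    rw [sortBy_eq_iff, and_iff_right_iff_imp]
    intro h u v huv
    rcases Relation.reflTransGen_iff_eq_or_transGen.1 huv with rfl | huv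
    · exact le_rfl
    · have h3 := h (hπ.symm_lt huv)
      rw [Prod.Lex.toLex_lt_toLex] at h3
      simp only [Equiv.apply_symm_apply] at h3
      rcases h3 with h3 | h3
      · exact h3.le
      · exact h3.1.le
  have h0 : OrderPoly.count (closure D hD) m = Nat.card {σ : Fin (k + 1) → Fin m //
      ∀ u v, Relation.ReflTransGen D.Adj u v → σ u ≤ σ v} := rfl
  rw [h0, Nat.card_eq_fintype_card, Fintype.card_subtype,
    Finset.card_eq_sum_card_fiberwise (f := sortBy ν)
      (t := Finset.univ.filter fun π => Respects D π)
      (fun σ hσ => by simpa using h1 σ (by simpa using hσ))]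
  refine Finset.sum_congr rfl fun π hπ => ?_
  rw [Finset.filter_filter, ← Fintype.card_subtype, ← Nat.card_eq_fintype_card,
    ← Nat.eq_sub_of_add_eq (ascentsBefore_add_listCost hν π),
    ← LabelledOrder.card_strictMono_toLex]
  exact Nat.card_congr <| (Equiv.arrowCongr π.symm (Equiv.refl (Fin m))).subtypeEquiv fun σ => by
    rw [h2 π (Finset.mem_filter.1 hπ).2]
    rfl

/-! ### From descent polynomials to binomial expansions -/

/-- The additive map that sends `X ^ e` to the binomial polynomial `X + (n - 1 - e)` choose `n`. -/
noncomputable def toBinomial (n : ℕ) : ℤ[X] →ₗ[ℤ] ℚ[X] :=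
  (basisMonomials ℤ).constr ℤ fun e => Ring.choose (X + ((n : ℚ[X]) - 1 - (e : ℚ[X]))) n

theorem toBinomial_X_pow (n e : ℕ) :
    toBinomial n (X ^ e) = Ring.choose (X + ((n : ℚ[X]) - 1 - (e : ℚ[X]))) n := by
  rw [X_pow_eq_monomial]
  exact (basisMonomials ℤ).constr_basis ℤ _ e

/-- Multiplication by `(1 - X) ^ 2` corresponds to a second difference, which lowers binomials by
two degrees. -/
theorem toBinomial_mul (n e : ℕ) : toBinomial (n + 2) ((1 - X) ^ 2 * X ^ e)
    = Ring.choose (X + ((n : ℚ[X]) - 1 - (e : ℚ[X]))) n := by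
  have h1 : ((1 - X) ^ 2 * X ^ e : ℤ[X]) = X ^ e - X ^ (e + 1) - (X ^ (e + 1) - X ^ (e + 2)) := by
    ring
  have h2 : (X + (((n + 2 : ℕ) : ℚ[X]) - 1 - ((e : ℕ) : ℚ[X])) : ℚ[X])
      = X + ((n : ℚ[X]) - 1 - (e : ℚ[X])) + 1 + 1 := by push_cast; ring
  have h3 : (X + (((n + 2 : ℕ) : ℚ[X]) - 1 - ((e + 1 : ℕ) : ℚ[X])) : ℚ[X])
      = X + ((n : ℚ[X]) - 1 - (e : ℚ[X])) + 1 := by push_cast; ring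
  have h4 : (X + (((n + 2 : ℕ) : ℚ[X]) - 1 - ((e + 2 : ℕ) : ℚ[X])) : ℚ[X])
      = X + ((n : ℚ[X]) - 1 - (e : ℚ[X])) := by push_cast; ring
  rw [h1, map_sub, map_sub, map_sub, toBinomial_X_pow, toBinomial_X_pow, toBinomial_X_pow, h2, h3,
    h4, Ring.choose_succ_succ (_ + 1) (n + 1), Ring.choose_succ_succ _ (n + 1),
    Ring.choose_succ_succ _ n]
  ring

theorem eval_choose_X_add (m a n : ℕ) :
    (Ring.choose (X + (a : ℚ[X])) n).eval (m : ℚ) = ((m + a).choose n : ℚ) := by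
  have := Ring.map_choose (evalRingHom (m : ℚ)) (X + (a : ℚ[X])) n
  simp only [coe_evalRingHom, eval_add, eval_X, eval_natCast] at this
  rw [this, ← Nat.cast_add, Ring.choose_natCast]

theorem Psi_eq_toBinomial {k : ℕ} {D : Digraph (Fin (k + 1))} (hD : IsAcyclic D) :
    Psi D = toBinomial (k + 1)
      (LabelledOrder.descentPoly (Relation.TransGen D.Adj) Fin.val) := by
  classical
  rw [LabelledOrder.descentPoly, ← sum_respects hD, map_sum, Psi]
  refine Finset.sum_congr (by congr) fun π hπ => ?_
  have h := deltaSum_add_listCost (Finset.mem_filter.1 hπ).2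
  rw [toBinomial_X_pow]
  congr 2
  have h' : (deltaSum D π : ℚ[X]) + (LabelledOrder.listCost (LabelledOrder.descent
      (Relation.TransGen D.Adj) Fin.val) (List.ofFn π) : ℕ) = (k : ℕ) := by exact_mod_cast h
  rw [eq_sub_of_add_eq h']
  push_cast
  ring

theorem orderPolynomial_eq_toBinomial {k : ℕ} {D : Digraph (Fin (k + 1))} (hD : IsAcyclic D)
    {ν : Equiv.Perm (Fin (k + 1))} (hν : ∀ a b, Relation.TransGen D.Adj a b → ν a < ν b) :
    OrderPoly.orderPolynomial (closure D hD) = toBinomial (k + 1)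
      (LabelledOrder.descentPoly (Relation.TransGen D.Adj) fun v => (ν v : ℕ)) := by
  classical
  symm
  apply OrderPoly.eq_orderPolynomial
  intro m _
  rw [LabelledOrder.descentPoly, ← sum_respects hD, map_sum, eval_finsetSum, count_closure hD hν]
  push_cast
  refine Finset.sum_congr rfl fun π _ => ?_
  have h := Nat.le.intro ((add_comm _ _).trans (ascentsBefore_add_listCost hν π))
  rw [toBinomial_X_pow, ← eval_choose_X_add, Nat.cast_sub h]
  congr 3
  push_cast
  ring

theorem W_eq_empty_iff {n : ℕ} {D : Digraph (Fin n)} (hD : IsAcyclic D) :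
    W D = ∅ ↔ ¬ ∃ a b c, LabelledOrder.Crossing (Relation.TransGen D.Adj) Fin.val a b c := by
  have := isStrictOrder_transGen hD
  rw [← Set.not_nonempty_iff_eq_empty, not_iff_not]
  constructor
  · rintro ⟨s, a, b, c, hab, hbc, -, hca, ⟨h1, h2⟩, h3, h4⟩
    exact ⟨a, b, c, hab, hbc, .single hca, h1, h2, h4, h3⟩
  · rintro ⟨a, b, c, h⟩
    obtain ⟨a, c, h, hcov⟩ := h.exists_cover Fin.val_injective
    -- A covering pair of the transitive closure is an arc.
    have hca : D.Adj c a := by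
      rcases Relation.TransGen.head'_iff.1 h.rel with ⟨z, h5, h6⟩
      rcases Relation.reflTransGen_iff_eq_or_transGen.1 h6 with rfl | h7
      · exact h5
      · exact absurd h7 (hcov z (.single h5))
    exact ⟨{a, b, c}, a, b, c, h.lt₁, h.lt₂, rfl, hca, ⟨h.not_ab, h.not_ba⟩, h.not_cb, h.not_bc⟩

end AcyclicDigraph

/-! ### The difference `Ψ(D, x) - Ω(D̄, x)` -/

theorem mainTheorem2 (n : ℕ) (hn : 3 ≤ n) (D : Digraph (Fin n))
    (hD : AcyclicDigraph.IsAcyclic D) :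
    (∃ d : Fin (n - 2) → ℕ,
      AcyclicDigraph.Psi D - OrderPoly.orderPolynomial (AcyclicDigraph.closure D hD)
        = ∑ i : Fin (n - 2),
            (d i : Polynomial ℚ) *
              Ring.choose (Polynomial.X + ((i : ℕ) : Polynomial ℚ)) (n - 2) ∧
      ((∀ i, d i = 0) ↔ AcyclicDigraph.W D = ∅)) ∧
    (AcyclicDigraph.Psi D = OrderPoly.orderPolynomial (AcyclicDigraph.closure D hD) ↔
      AcyclicDigraph.W D = ∅) := by
  classical
  obtain ⟨k, rfl⟩ : ∃ k, n = k + 2 := ⟨n - 2, by omega⟩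
  simp only [Nat.add_sub_cancel]
  have := AcyclicDigraph.isStrictOrder_transGen hD
  obtain ⟨ν, hν⟩ := LabelledOrder.exists_natural_labelling (Relation.TransGen D.Adj)
  set E : Fin (k + 2) → Finset (List (Fin (k + 2)) × List (Fin (k + 2))) := fun u =>
    LabelledOrder.exceptionalCuts (Relation.TransGen D.Adj)
      (LabelledOrder.mixedLabel ν Fin.val (ν u + 1)) u with hE
  set K : (Σ _ : Fin (k + 2), List (Fin (k + 2)) × List (Fin (k + 2))) → ℕ := fun x =>
    LabelledOrder.cutCost (Relation.TransGen D.Adj)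
      (LabelledOrder.mixedLabel ν Fin.val (ν x.1 + 1)) x.2 with hK
  have hKlt : ∀ x ∈ Finset.univ.sigma E, K x < k := by
    intro x hx
    have := LabelledOrder.cutCost_lt_of_exceptional (Finset.mem_sigma.1 hx).2
    simpa using this
  -- The exceptional cuts with `e` descents account for the coefficient with index `k - 1 - e`.
  let d : Fin k → ℕ := fun i => ((Finset.univ.sigma E).filter fun x => K x = k - 1 - i).card
  have hd : (∀ i, d i = 0) ↔ AcyclicDigraph.W D = ∅ := by
    rw [AcyclicDigraph.W_eq_empty_iff hD, ← LabelledOrder.exists_exceptionalCuts_nonempty_iff hν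
      Fin.val_injective Fin.isLt]
    constructor
    · rintro h ⟨u, p, hp⟩
      have h1 : (⟨u, p⟩ : Σ _ : Fin (k + 2), _) ∈ Finset.univ.sigma E := by simpa using hp
      have h2 := hKlt _ h1
      refine Finset.card_ne_zero_of_mem (Finset.mem_filter.2 ⟨h1, ?_⟩)
        (h ⟨k - 1 - K ⟨u, p⟩, by omega⟩)
      simp only
      omega
    · intro h i
      refine Finset.card_eq_zero.2 (Finset.filter_eq_empty_iff.2 fun x hx _ => h ⟨x.1, x.2, ?_⟩)
      exact (Finset.mem_sigma.1 hx).2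
  have hsum : AcyclicDigraph.Psi D - OrderPoly.orderPolynomial (AcyclicDigraph.closure D hD)
      = ∑ i : Fin k, (d i : ℚ[X]) * Ring.choose (X + ((i : ℕ) : ℚ[X])) k := by
    rw [AcyclicDigraph.Psi_eq_toBinomial hD, AcyclicDigraph.orderPolynomial_eq_toBinomial hD hν,
      ← map_sub, LabelledOrder.descentPoly_sub_natural ν Fin.val_injective Fin.isLt
        (LabelledOrder.exceptionalCuts_mixedLabel_eq_empty hν Fin.val_injective Fin.isLt),
      ← Finset.sum_sigma _ _ fun x => (X : ℤ[X]) ^ K x, Finset.mul_sum, map_sum]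
    have h1 : ∀ i : Fin k, ∀ x ∈ (Finset.univ.sigma E).filter (fun x => K x = k - 1 - i),
        AcyclicDigraph.toBinomial (k + 1 + 1) ((1 - X) ^ 2 * X ^ K x)
          = Ring.choose (X + ((i : ℕ) : ℚ[X])) k := by
      intro i x hx
      rw [AcyclicDigraph.toBinomial_mul, (Finset.mem_filter.1 hx).2]
      have h2 : ((k - 1 - i : ℕ) : ℚ[X]) + (i + 1 : ℕ) = (k : ℕ) := by
        norm_cast
        have := i.isLt
        omega
      congr 2
      rw [eq_sub_of_add_eq h2]
      push_cast
      ring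
    have h3 : ∀ i : Fin k, (d i : ℚ[X]) * Ring.choose (X + ((i : ℕ) : ℚ[X])) k
        = ∑ x ∈ (Finset.univ.sigma E).filter (fun x => K x = k - 1 - i),
            AcyclicDigraph.toBinomial (k + 1 + 1) ((1 - X) ^ 2 * X ^ K x) := by
      intro i
      rw [Finset.sum_congr rfl (h1 i), Finset.sum_const, nsmul_eq_mul]
    rw [Finset.sum_congr rfl fun i _ => h3 i, ← Finset.sum_biUnion]
    · refine Finset.sum_congr ?_ fun _ _ => rfl
      ext x
      simp only [Finset.mem_biUnion, Finset.mem_univ, true_and, Finset.mem_filter]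
      refine ⟨fun hx => ?_, fun ⟨_, hx, _⟩ => hx⟩
      have := hKlt x hx
      exact ⟨⟨k - 1 - K x, by omega⟩, hx, by simp only; omega⟩
    · intro i _ j _ hij
      refine Finset.disjoint_left.2 fun x hx hx' => hij (Fin.ext ?_)
      have h4 := (Finset.mem_filter.1 hx).2
      have h5 := (Finset.mem_filter.1 hx').2
      omega
  refine ⟨⟨d, hsum, hd⟩, ?_⟩
  rw [← hd, ← sub_eq_zero, hsum]
  constructor
  · -- At `X = k` all the binomials are positive.
    intro h i
    have h1 := congrArg (eval (k : ℚ)) h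
    simp only [eval_finsetSum, eval_mul, eval_natCast, eval_zero,
      AcyclicDigraph.eval_choose_X_add] at h1
    have h2 : ∑ i : Fin k, d i * (k + i).choose k = 0 := by exact_mod_cast h1
    have h3 := Finset.sum_eq_zero_iff.1 h2 i (Finset.mem_univ i)
    exact (Nat.mul_eq_zero.1 h3).resolve_right (Nat.choose_pos (by omega)).ne'
  · intro h
    simp [h]
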